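/- Let $n\ge 3$, and let $\overline{\Pi}_n$ be the poset of all partitions of $\{1,\dots,n\}$ other than the partition into singletons and the partition with a single block, ordered by refinement (finer is smaller). Let $\Delta(\overline{\Pi}_n)$ be its nerve (order complex), whose simplices are the nonempty finite chains in $\overline{\Pi}_n$; a simplex with $k+1$ vertices has dimension $k$. Let $\mathcal F(\Delta(\overline{\Pi}_n))$ be its face poset, consisting of the nonempty simplices ordered by inclusion. The symmetric group $S_n$ acts on all of these; put $S_1\times S_{n-1}:=\{\sigma\in S_n\mid \sigma(1)=1\}$. For a subgroup $G\subset S_n$, the face poset of the quotient $\Delta(\overline{\Pi}_n)/G$ is $\mathcal F(\Delta(\overline{\Pi}_n))/G$: its elements are the $G$-orbits of simplices, and an orbit $x$ is $\le$ an orbit $y$ if and only if some representative of $x$ is a face of some representative of $y$. A *partial matching* on a poset $P$ is a set $M\subset P\times P$ such that $b$ covers $a$ for every $(a,b)\in M$ and every element of $P$ belongs to at most one pair in $M$. It is *acyclic* if there are no $m\ge 2$ and pairs $(a_1,b_1),\dots,(a_m,b_m)\in M$ with $b_1,\dots,b_m$ distinct such that $b_{i+1}$ covers $a_i$ for all $i$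 (where $b_{m+1}:=b_1$). The *critical* elements of $M$ are the elements of $P$ that belong to no pair in $M$. Let $C_n$ be the set of all simplices of $\Delta(\overline{\Pi}_n)$ of dimension $n-3$ all of whose vertices are partitions in which every block not containing $1$ is a singleton, and let $\alpha_n$ be the vertex $\{\{1\},\{2,\dots,n\}\}$ of $\Delta(\overline{\Pi}_n)$. Then for every subgroup $G\subset S_1\times S_{n-1}$ there exists an acyclic matching on the poset $\mathcal F(\Delta(\overline{\Pi}_n))/G$ whose set of critical elements consists exactly of the $G$-orbits of the simplices in $C_n$ together with the $G$-orbit of $\alpha_n$. -/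

import Mathlib

/-! ### Acyclic matchings on posets -/

/-- A partial matching on a poset: a set of pairs `(a, b)` such that `b` covers `a` and every element
of the poset belongs to at most one of the pairs. -/
structure IsPartialMatching {P : Type*} [PartialOrder P] (M : Set (P × P)) : Prop where
  covBy : ∀ p ∈ M, p.1 ⋖ p.2
  unique : ∀ x : P, ∀ p ∈ M, ∀ q ∈ M, (x = p.1 ∨ x = p.2) → (x = q.1 ∨ x = q.2) → p = q

/-- A partial matching is acyclic if there is no cycle
`b 0 ⋗ a 0 ⋖ b 1 ⋗ a 1 ⋖ ⋯ ⋖ b (m - 1) ⋗ a (m - 1) ⋖ b 0` with `m ≥ 2`, all `b i` distinct and all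
`(a i, b i)` in the matching. Here `m = k + 2`, and `i + 1` is taken modulo `m`. -/
structure IsAcyclicMatching {P : Type*} [PartialOrder P] (M : Set (P × P)) : Prop
    extends IsPartialMatching M where
  acyclic : ¬ ∃ (k : ℕ) (a b : Fin (k + 2) → P), Function.Injective b ∧
    ∀ i, (a i, b i) ∈ M ∧ a i ⋖ b (i + 1)

/-- The critical elements of a matching are the elements that belong to none of its pairs. -/
def criticalElements {P : Type*} (M : Set (P × P)) : Set P :=
  {x | ∀ p ∈ M, x ≠ p.1 ∧ x ≠ p.2}

/-! ### The partition lattice and its order complex -/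

/-- The partitions of an `n`-element set, given by their equivalence relations and ordered by
refinement (finer is smaller), without the smallest and the greatest one. The ground set is `Fin n`;
its element `0` plays the role of the point `1` of `{1, …, n}`. -/
abbrev ProperPartition (n : ℕ) : Type := {s : Setoid (Fin n) // s ≠ ⊥ ∧ s ≠ ⊤}

/-- The permutation `g` sends a partition to the partition whose blocks are the images under `g`:
`x` and `y` are equivalent in `g • s` iff `g⁻¹ x` and `g⁻¹ y` are equivalent in `s`. -/
instance ProperPartition.instMulAction (n : ℕ) :
    MulAction (Equiv.Perm (Fin n)) (ProperPartition n) where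
  smul g s := ⟨s.1.comap ⇑g⁻¹, by
    refine ⟨fun h => s.2.1 ?_, fun h => s.2.2 ?_⟩
    · refine le_bot_iff.1 fun x y hxy => ?_
      have h1 : s.1.comap ⇑g⁻¹ (g x) (g y) := by simpa [Setoid.comap_rel] using hxy
      rw [h] at h1
      exact g.injective h1
    · refine top_le_iff.1 fun x y _ => ?_
      have h1 : s.1.comap ⇑g⁻¹ (g x) (g y) := by rw [h]; trivial
      simpa [Setoid.comap_rel] using h1⟩
  one_smul _ := rfl
  mul_smul _ _ _ := rfl

theorem ProperPartition.smul_rel {n : ℕ} (g : Equiv.Perm (Fin n)) (s : ProperPartition n)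
    (x y : Fin n) : (g • s).1 x y ↔ s.1 (g⁻¹ x) (g⁻¹ y) := Iff.rfl

theorem ProperPartition.smul_mono {n : ℕ} (g : Equiv.Perm (Fin n)) {s t : ProperPartition n}
    (h : s ≤ t) : g • s ≤ g • t := fun _ _ hxy => h hxy

/-- The face poset of the nerve (order complex) of the poset of proper partitions. Its elements are
the nonempty simplices, that is the nonempty finite chains of proper partitions, and the order is
inclusion. -/
abbrev PartitionSimplex (n : ℕ) : Type :=
  {c : Finset (ProperPartition n) // c.Nonempty ∧ IsChain (· ≤ ·) (c : Set (ProperPartition n))}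

/-- The dimension of a simplex: the number of its vertices minus one. -/
def PartitionSimplex.dim {n : ℕ} (c : PartitionSimplex n) : ℕ := c.1.card - 1

/-- Permutations act on simplices by acting on the vertices. -/
instance PartitionSimplex.instMulAction (n : ℕ) :
    MulAction (Equiv.Perm (Fin n)) (PartitionSimplex n) where
  smul g c := ⟨c.1.map (MulAction.toPerm g).toEmbedding, by
    refine ⟨c.2.1.map, ?_⟩
    intro x hx y hy hxy
    simp only [Finset.coe_map, Set.mem_image, Finset.mem_coe] at hx hy
    obtain ⟨x, hx, rfl⟩ := hx
    obtain ⟨y, hy, rfl⟩ := hy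
    rcases c.2.2.total hx hy with h | h
    · exact Or.inl (ProperPartition.smul_mono g h)
    · exact Or.inr (ProperPartition.smul_mono g h)⟩
  one_smul c := by
    apply Subtype.ext
    change c.1.map _ = c.1
    ext x
    simp
  mul_smul g h c := by
    apply Subtype.ext
    change c.1.map _ = (c.1.map _).map _
    rw [Finset.map_map]
    congr 1

theorem PartitionSimplex.smul_val {n : ℕ} (g : Equiv.Perm (Fin n)) (c : PartitionSimplex n) :
    (g • c).1 = c.1.map (MulAction.toPerm g).toEmbedding := rfl

theorem PartitionSimplex.smul_mono {n : ℕ} (g : Equiv.Perm (Fin n)) {c d : PartitionSimplex n}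
    (h : c ≤ d) : g • c ≤ g • d := Finset.map_subset_map.2 h

/-! ### The quotient by a group of permutations -/

/-- The simplices of the quotient of the order complex by `G`: the `G`-orbits of simplices. -/
def QuotientSimplex (n : ℕ) (G : Subgroup (Equiv.Perm (Fin n))) : Type :=
  MulAction.orbitRel.Quotient G (PartitionSimplex n)

/-- The class of a simplex in the quotient. -/
def QuotientSimplex.mk {n : ℕ} (G : Subgroup (Equiv.Perm (Fin n))) (c : PartitionSimplex n) :
    QuotientSimplex n G :=
  Quotient.mk (MulAction.orbitRel G (PartitionSimplex n)) c

theorem QuotientSimplex.mk_eq_mk {n : ℕ} {G : Subgroup (Equiv.Perm (Fin n))}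
    {c d : PartitionSimplex n} : mk G c = mk G d ↔ ∃ g ∈ G, g • c = d := by
  rw [eq_comm]
  refine Quotient.eq.trans ?_
  rw [MulAction.orbitRel_apply]
  constructor
  · rintro ⟨g, h⟩
    exact ⟨g.1, g.2, h⟩
  · rintro ⟨g, hg, h⟩
    exact ⟨⟨g, hg⟩, h⟩

/-- The order of the face poset of the quotient: `x` is a face of `y` iff some representative of `x`
is a face of some representative of `y`. -/
instance QuotientSimplex.instPartialOrder (n : ℕ) (G : Subgroup (Equiv.Perm (Fin n))) :
    PartialOrder (QuotientSimplex n G) where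
  le x y := ∃ c d : PartitionSimplex n, mk G c = x ∧ mk G d = y ∧ c ≤ d
  le_refl x := by
    obtain ⟨c, rfl⟩ := Quotient.exists_rep x
    exact ⟨c, c, rfl, rfl, le_rfl⟩
  le_trans := by
    rintro _ _ _ ⟨c, d, rfl, rfl, hcd⟩ ⟨d', e, hd, rfl, hde⟩
    obtain ⟨g, hg, rfl⟩ := mk_eq_mk.1 hd
    refine ⟨c, g • e, rfl, (mk_eq_mk.2 ⟨g, hg, rfl⟩).symm, ?_⟩
    exact hcd.trans (PartitionSimplex.smul_mono g hde)
  le_antisymm := by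
    rintro x y ⟨c, d, hc, hd, hcd⟩ ⟨d', c', hd', hc', hdc⟩
    obtain ⟨g, hg, rfl⟩ := mk_eq_mk.1 (hd'.trans hd.symm)
    obtain ⟨h, hh, rfl⟩ := mk_eq_mk.1 (hc.trans hc'.symm)
    have h1 : d'.1.card ≤ c.1.card := by
      simpa [PartitionSimplex.smul_val] using Finset.card_le_card hdc
    have h2 : c = g • d' := by
      refine Subtype.ext (Finset.eq_of_subset_of_card_le hcd ?_)
      simpa [PartitionSimplex.smul_val] using h1
    rw [← hc, ← hd, h2]

theorem QuotientSimplex.mk_le_mk {n : ℕ} {G : Subgroup (Equiv.Perm (Fin n))}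
    {c d : PartitionSimplex n} : mk G c ≤ mk G d ↔ ∃ g ∈ G, g • c ≤ d := by
  constructor
  · rintro ⟨c', d', hc, hd, h⟩
    obtain ⟨g, hg, rfl⟩ := mk_eq_mk.1 hc.symm
    obtain ⟨k, hk, rfl⟩ := mk_eq_mk.1 hd
    exact ⟨k * g, G.mul_mem hk hg, by rw [mul_smul]; exact PartitionSimplex.smul_mono k h⟩
  · rintro ⟨g, hg, h⟩
    exact ⟨g • c, d, (mk_eq_mk.2 ⟨g, hg, rfl⟩).symm, rfl, h⟩

/-! ### The critical simplices -/

/-- The set `A` of vertices all of whose blocks not containing the base point are singletons. -/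
def baseBlockVertices (n : ℕ) [NeZero n] : Set (ProperPartition n) :=
  {s | ∀ B ∈ s.1.classes, (0 : Fin n) ∉ B → ∃ x, B = {x}}

/-- The set `C_n` of simplices of dimension `n - 3` with all vertices in `A` (used for `n ≥ 3`). -/
def baseSimplices (n : ℕ) [NeZero n] : Set (PartitionSimplex n) :=
  {c | (∀ s ∈ c.1, s ∈ baseBlockVertices n) ∧ c.dim = n - 3}

/-- The vertex `α_n`: the partition into the base point and its complement. -/
def alphaPartition (n : ℕ) [NeZero n] (hn : 3 ≤ n) : ProperPartition n :=
  ⟨Setoid.ker (fun x : Fin n => x = 0), by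
    have h1 : (⟨1, by omega⟩ : Fin n) ≠ 0 := by simp [Fin.ext_iff]
    have h2 : (⟨2, by omega⟩ : Fin n) ≠ 0 := by simp [Fin.ext_iff]
    constructor
    · intro h
      have h3 : Setoid.ker (fun x : Fin n => x = 0) ⟨1, by omega⟩ ⟨2, by omega⟩ := by
        simp [Setoid.ker_def, h1, h2]
      rw [h] at h3
      have h4 : (⟨1, by omega⟩ : Fin n) = ⟨2, by omega⟩ := h3
      simp [Fin.ext_iff] at h4
    · intro h
      have h3 : Setoid.ker (fun x : Fin n => x = 0) ⟨1, by omega⟩ 0 := by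
        rw [h]; trivial
      simp [Setoid.ker_def, h1] at h3⟩

theorem alphaPartition_classes (n : ℕ) [NeZero n] (hn : 3 ≤ n) :
    (alphaPartition n hn).1.classes = {{0}, {0}ᶜ} := by
  have h1 : (⟨1, by omega⟩ : Fin n) ≠ 0 := by simp [Fin.ext_iff]
  have hr : ∀ x y : Fin n, (alphaPartition n hn).1 x y ↔ (x = 0 ↔ y = 0) := fun x y => by
    change ((x = 0) = (y = 0)) ↔ _
    exact eq_iff_iff
  ext B
  constructor
  · rintro ⟨y, rfl⟩
    by_cases hy : y = 0
    · left; ext x; simp [hr, hy]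
    · right; ext x; simp [hr, hy]
  · rintro (rfl | rfl)
    · exact ⟨0, by ext x; simp [hr]⟩
    · exact ⟨⟨1, by omega⟩, by ext x; simp [hr, h1]⟩

/-- The simplex whose only vertex is `α_n`. -/
def alphaSimplex (n : ℕ) [NeZero n] (hn : 3 ≤ n) : PartitionSimplex n :=
  ⟨{alphaPartition n hn}, Finset.singleton_nonempty _, by simp⟩

/-! The matching is one canonical toggle. Call a partition base if its blocks away from the base
point are singletons. For a simplex `c`, let `K = runLength c`: the base vertices with base blocks
of sizes `2, …, K - 1` are present, and the one of size `K` is missing. Let `B` be the largest base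
block in this run (`{0}` if the run is empty) and `t` the smallest vertex of base size at least `K`
(`⊤` if there is none). Splitting the base block of `t` into `B` and the rest gives `toggle c`,
which is comparable to every vertex (`le_or_le_toggle`).

If `K < n`, this partition is not base (`runLength_eq_of_isBase_toggle`), and its base size is `K -
1`. Adding or removing it therefore changes neither `K`, `B` nor `t`, so toggling is an involution
(`toggle_congr`). It fails only when `K = n`, which characterizes `C_n` (`runLength_eq_iff`), or
when removal would leave the empty simplex, which happens only at `α_n`.

For acyclicity, `gradientHeight` is constant on matched pairs and monotone under inclusion; when a
face has the same height, it has the same toggle (`gradientHeight_lt_or_toggle_eq`). So the height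
increases strictly around a would-be cycle.

The construction uses only the base point, block sizes and refinement. It commutes with every
permutation fixing the base point, and so descends to the quotient without choosing representatives.
-/

/-! ### Blocks of the base point -/

/-- The block of the base point. -/
def baseBlock {n : ℕ} [NeZero n] (s : Setoid (Fin n)) : Set (Fin n) := {x | s 0 x}

/-- The number of elements of the block of the base point. -/
noncomputable def baseSize {n : ℕ} [NeZero n] (s : Setoid (Fin n)) : ℕ := (baseBlock s).ncard

/-- All blocks that do not contain the base point are singletons. -/
def IsBase {n : ℕ} [NeZero n] (s : Setoid (Fin n)) : Prop := ∀ x y, s x y → x ≠ y → s 0 x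

section Setoids

variable {n : ℕ} [NeZero n] {s t : Setoid (Fin n)}

theorem mem_baseBlock {x : Fin n} : x ∈ baseBlock s ↔ s 0 x := Iff.rfl

theorem mem_baseBlockVertices {s : ProperPartition n} :
    s ∈ baseBlockVertices n ↔ IsBase s.1 := by
  constructor
  · intro h x y hxy hne
    by_contra h0
    obtain ⟨z, hz⟩ := h {w | s.1 w x} ⟨x, rfl⟩ h0
    have hx : x ∈ ({z} : Set (Fin n)) := hz ▸ s.1.refl x
    have hy : y ∈ ({z} : Set (Fin n)) := hz ▸ s.1.symm hxy
    exact hne (hx.trans hy.symm)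
  · rintro h B ⟨x, rfl⟩ h0
    refine ⟨x, Set.eq_singleton_iff_unique_mem.2 ⟨s.1.refl x, fun y hy => ?_⟩⟩
    by_contra hne
    exact h0 (s.1.trans (h y x hy hne) hy)

theorem baseBlock_mono (h : s ≤ t) : baseBlock s ⊆ baseBlock t := fun _ hx => h hx

theorem baseSize_mono (h : s ≤ t) : baseSize s ≤ baseSize t :=
  Set.ncard_le_ncard (baseBlock_mono h)

theorem baseBlock_eq_of_le (h : s ≤ t) (hc : baseSize t ≤ baseSize s) :
    baseBlock s = baseBlock t :=
  Set.eq_of_subset_of_ncard_le (baseBlock_mono h) hc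

theorem one_le_baseSize (s : Setoid (Fin n)) : 1 ≤ baseSize s :=
  (Set.ncard_pos (Set.toFinite _)).2 ⟨0, s.refl 0⟩

theorem baseSize_top : baseSize (⊤ : Setoid (Fin n)) = n := by
  have : baseBlock (⊤ : Setoid (Fin n)) = Set.univ := Set.eq_univ_of_forall fun _ => trivial
  simp [baseSize, this, Set.ncard_univ]

theorem baseSize_lt (h : s ≠ ⊤) : baseSize s < n := by
  refine lt_of_le_of_ne ?_ fun he => h ?_
  · exact (baseSize_mono le_top).trans_eq baseSize_top
  · have h1 := baseBlock_eq_of_le (le_top : s ≤ ⊤) (by rw [baseSize_top, he])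
    have h2 : ∀ x, s 0 x := fun x => by
      have : x ∈ baseBlock s := h1 ▸ trivial
      exact this
    exact top_le_iff.1 fun x y _ => s.trans (s.symm (h2 x)) (h2 y)

/-- A nontrivial block of `s` away from the base point would be absorbed by the base block of `t`,
enlarging it by at least two elements. -/
theorem IsBase.of_le (ht : IsBase t) (h : s ≤ t) (hc : baseSize t ≤ baseSize s + 1) :
    IsBase s := by
  intro x y hxy hne
  by_contra hx
  have hy : ¬ s 0 y := fun hy => hx (s.trans hy (s.symm hxy))
  have hsub : insert x (insert y (baseBlock s)) ⊆ baseBlock t := by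
    rintro z (rfl | rfl | hz)
    · exact ht z y (h hxy) hne
    · exact ht z x (t.symm (h hxy)) hne.symm
    · exact h hz
  have h1 := Set.ncard_le_ncard hsub
  rw [Set.ncard_insert_of_notMem (by simp [hne, mem_baseBlock, hx]),
    Set.ncard_insert_of_notMem (by simpa [mem_baseBlock] using hy)] at h1
  unfold baseSize at hc
  omega

theorem IsBase.eq_of_baseBlock_eq (hs : IsBase s) (ht : IsBase t)
    (h : baseBlock s = baseBlock t) : s = t := by
  have h' : ∀ x, s 0 x ↔ t 0 x := fun x => Set.ext_iff.1 h x
  ext x y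
  rcases eq_or_ne x y with rfl | hne
  · exact ⟨fun _ => t.refl x, fun _ => s.refl x⟩
  · constructor
    · intro hxy
      exact t.trans (t.symm ((h' x).1 (hs x y hxy hne))) ((h' y).1 (hs y x (s.symm hxy) hne.symm))
    · intro hxy
      exact s.trans (s.symm ((h' x).2 (ht x y hxy hne))) ((h' y).2 (ht y x (t.symm hxy) hne.symm))

theorem IsBase.two_le_baseSize (hs : IsBase s) (h : s ≠ ⊥) : 2 ≤ baseSize s := by
  by_contra! hlt
  have h1 := baseBlock_eq_of_le (bot_le : ⊥ ≤ s) (by have := one_le_baseSize (⊥ : Setoid (Fin n)); omega)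
  exact h (hs.eq_of_baseBlock_eq (fun x y hxy hne => absurd hxy hne) h1.symm)

end Setoids

/-! ### The run of a simplex -/

theorem le_or_le_of_mem {n : ℕ} {c : PartitionSimplex n} {s t : ProperPartition n}
    (hs : s ∈ c.1) (ht : t ∈ c.1) : s.1 ≤ t.1 ∨ t.1 ≤ s.1 := c.2.2.total hs ht

section Run

variable {n : ℕ} [NeZero n]

/-- The least `k ≥ 2` such that no vertex is a partition with a block of `k` elements containing the
base point and all other blocks singletons. -/
noncomputable def runLength (c : PartitionSimplex n) : ℕ :=
  sInf {k | 2 ≤ k ∧ ∀ s ∈ c.1, IsBase s.1 → baseSize s.1 ≠ k}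

/-- The largest block reached by the initial run. -/
def runBlock (c : PartitionSimplex n) : Set (Fin n) :=
  {x | x = 0 ∨ ∃ s ∈ c.1, IsBase s.1 ∧ baseSize s.1 < runLength c ∧ s.1 0 x}

/-- The smallest vertex whose base block exceeds the initial run, or `⊤` if there is none. -/
noncomputable def nextPart (c : PartitionSimplex n) : Setoid (Fin n) :=
  sInf {s | ∃ t ∈ c.1, t.1 = s ∧ runLength c ≤ baseSize s}

/-- The partition that the matching adds to a simplex or removes from it: in the next partition, the
part of the base block outside the run is split off. -/
noncomputable def toggle (c : PartitionSimplex n) : Setoid (Fin n) :=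
  nextPart c ⊓ Setoid.ker (· ∈ runBlock c)

variable {c d : PartitionSimplex n}

theorem toggle_rel {x y : Fin n} :
    toggle c x y ↔ nextPart c x y ∧ (x ∈ runBlock c ↔ y ∈ runBlock c) := by
  rw [toggle, Setoid.inf_iff_and, Setoid.ker_def, eq_iff_iff]

theorem toggle_le_nextPart : toggle c ≤ nextPart c := inf_le_left

theorem zero_mem_runBlock : 0 ∈ runBlock c := Or.inl rfl

theorem le_of_baseSize_lt {s t : ProperPartition n} (hs : s ∈ c.1) (ht : t ∈ c.1)
    (h : baseSize s.1 < baseSize t.1) : s.1 ≤ t.1 :=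
  (le_or_le_of_mem hs ht).resolve_right fun h1 => (baseSize_mono h1).not_gt h

theorem runLength_spec (hn : 2 ≤ n) (c : PartitionSimplex n) :
    2 ≤ runLength c ∧ ∀ s ∈ c.1, IsBase s.1 → baseSize s.1 ≠ runLength c :=
  Nat.sInf_mem (s := {k | 2 ≤ k ∧ ∀ s ∈ c.1, IsBase s.1 → baseSize s.1 ≠ k})
    -- Proper partitions have base size below `n`, so `n` is always a missing size and the infimum
    -- is attained.
    ⟨n, hn, fun s _ _ => (baseSize_lt s.2.2).ne⟩

theorem runLength_le (hn : 2 ≤ n) (c : PartitionSimplex n) : runLength c ≤ n :=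
  Nat.sInf_le ⟨hn, fun s _ _ => (baseSize_lt s.2.2).ne⟩

theorem exists_isBase_of_lt_runLength {k : ℕ} (h2 : 2 ≤ k) (hk : k < runLength c) :
    ∃ s ∈ c.1, IsBase s.1 ∧ baseSize s.1 = k := by
  by_contra! h
  exact hk.not_ge (Nat.sInf_le ⟨h2, h⟩)

/-- The base blocks in the run are nested, so their union is the one of size `K - 1`, unless the run
is empty. -/
theorem runBlock_cases (hn : 2 ≤ n) (c : PartitionSimplex n) :
    (runLength c = 2 ∧ runBlock c = {0}) ∨
      ∃ t ∈ c.1, IsBase t.1 ∧ baseSize t.1 + 1 = runLength c ∧ runBlock c = baseBlock t.1 := by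
  have h2 := (runLength_spec hn c).1
  rcases h2.eq_or_lt with h | h
  · refine Or.inl ⟨h.symm, Set.eq_singleton_iff_unique_mem.2 ⟨zero_mem_runBlock, ?_⟩⟩
    rintro x (hx | ⟨s, hs, hb, hlt, hx⟩)
    · exact hx
    · have := hb.two_le_baseSize s.2.1
      omega
  · obtain ⟨t, ht, hb, hk⟩ := exists_isBase_of_lt_runLength (c := c) (k := runLength c - 1)
      (by omega) (by omega)
    refine Or.inr ⟨t, ht, hb, by omega, Set.Subset.antisymm ?_ ?_⟩
    · rintro x (rfl | ⟨s, hs, hsb, hlt, hx⟩)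
      · exact t.1.refl 0
      · rcases le_or_le_of_mem hs ht with h1 | h1
        · exact h1 hx
        · rw [baseBlock_eq_of_le h1 (by omega)]
          exact hx
    · intro x hx
      exact Or.inr ⟨t, ht, hb, by omega, hx⟩

theorem ncard_runBlock (hn : 2 ≤ n) (c : PartitionSimplex n) :
    (runBlock c).ncard + 1 = runLength c := by
  rcases runBlock_cases hn c with ⟨h1, h2⟩ | ⟨t, -, -, h1, h2⟩
  · simp [h1, h2]
  · rw [h2, ← h1]
    rfl

theorem nextPart_cases (c : PartitionSimplex n) :
    (nextPart c = ⊤ ∧ ∀ t ∈ c.1, baseSize t.1 < runLength c) ∨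
      ∃ t ∈ c.1, runLength c ≤ baseSize t.1 ∧ nextPart c = t.1 := by
  classical
  by_cases h : ∀ t ∈ c.1, baseSize t.1 < runLength c
  · refine Or.inl ⟨?_, h⟩
    have : {s | ∃ t ∈ c.1, t.1 = s ∧ runLength c ≤ baseSize s} = ∅ := by
      refine Set.eq_empty_of_forall_notMem ?_
      rintro _ ⟨t, ht, rfl, h1⟩
      exact (h t ht).not_ge h1
    rw [nextPart, this, sInf_empty]
  · push Not at h
    obtain ⟨t₀, ht₀, hk₀⟩ := h
    obtain ⟨t, hmin⟩ := (c.1.filter fun t => runLength c ≤ baseSize t.1).exists_minimal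
      ⟨t₀, Finset.mem_filter.2 ⟨ht₀, hk₀⟩⟩
    obtain ⟨ht, hk⟩ := Finset.mem_filter.1 hmin.prop
    refine Or.inr ⟨t, ht, hk, le_antisymm (sInf_le ⟨t, ht, rfl, hk⟩) (le_sInf ?_)⟩
    rintro _ ⟨s, hs, rfl, hks⟩
    rcases le_or_le_of_mem ht hs with h1 | h1
    · exact h1
    · exact hmin.2 (Finset.mem_filter.2 ⟨hs, hks⟩) h1

theorem nextPart_le {s : ProperPartition n} (hs : s ∈ c.1) (hk : runLength c ≤ baseSize s.1) :
    nextPart c ≤ s.1 := sInf_le ⟨s, hs, rfl, hk⟩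

theorem runLength_le_baseSize_nextPart (hn : 2 ≤ n) : runLength c ≤ baseSize (nextPart c) := by
  rcases nextPart_cases c with ⟨h, -⟩ | ⟨t, -, hk, h⟩
  · rw [h, baseSize_top]
    exact runLength_le hn c
  · rwa [h]

theorem le_nextPart {s : ProperPartition n} (hs : s ∈ c.1) (hk : baseSize s.1 < runLength c) :
    s.1 ≤ nextPart c := by
  rcases nextPart_cases c with ⟨h, -⟩ | ⟨t, ht, hkt, h⟩
  · rw [h]
    exact le_top
  · rw [h]
    exact le_of_baseSize_lt hs ht (hk.trans_le hkt)

theorem runBlock_subset (hn : 2 ≤ n) : runBlock c ⊆ baseBlock (nextPart c) := by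
  rcases runBlock_cases hn c with ⟨-, h⟩ | ⟨t, ht, -, hk, h⟩
  · rw [h, Set.singleton_subset_iff]
    exact (nextPart c).refl 0
  · rw [h]
    exact baseBlock_mono (le_nextPart ht (by omega))

/-! ### The toggled partition: properness and comparability with the vertices -/

theorem baseBlock_toggle (hn : 2 ≤ n) : baseBlock (toggle c) = runBlock c := by
  ext x
  rw [mem_baseBlock, toggle_rel]
  exact ⟨fun h => h.2.1 zero_mem_runBlock, fun h =>
    ⟨runBlock_subset hn h, fun _ => h, fun _ => zero_mem_runBlock⟩⟩

theorem baseSize_toggle (hn : 2 ≤ n) : baseSize (toggle c) + 1 = runLength c := by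
  rw [baseSize, baseBlock_toggle hn, ncard_runBlock hn]

theorem toggle_ne_top (hn : 2 ≤ n) : toggle c ≠ ⊤ := by
  intro h
  have h1 := baseSize_toggle (c := c) hn
  have h2 := runLength_le hn c
  rw [h, baseSize_top] at h1
  omega

/-- If splitting off the part outside the run leaves only singletons there, then `nextPart c` is
itself base and exceeds the run block by at most one element. Its base size is then exactly
`runLength c`. No vertex can be such a partition, so it is `⊤`. -/
theorem runLength_eq_of_isBase_toggle (hn : 2 ≤ n) (hb : IsBase (toggle c)) : runLength c = n := by
  by_contra hne
  have hlt : runLength c < n := lt_of_le_of_ne (runLength_le hn c) hne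
  -- Two distinct related points outside the run block would stay related in `toggle c`, away from
  -- its base block.
  have key : ∀ x y, nextPart c x y → x ≠ y → x ∈ runBlock c ∨ y ∈ runBlock c := by
    intro x y hxy hne
    by_contra! h
    have h1 : toggle c x y := toggle_rel.2 ⟨hxy, by simp [h.1, h.2]⟩
    have h2 : x ∈ baseBlock (toggle c) := hb x y h1 hne
    rw [baseBlock_toggle hn] at h2
    exact h.1 h2
  have hbase : IsBase (nextPart c) := by
    intro x y hxy hne
    rcases key x y hxy hne with h | h
    · exact runBlock_subset hn h
    · exact (nextPart c).trans (runBlock_subset hn h) ((nextPart c).symm hxy)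
  have hle : baseSize (nextPart c) ≤ runLength c := by
    rw [← ncard_runBlock hn c]
    have h1 : (baseBlock (nextPart c) \ runBlock c).ncard ≤ 1 := by
      rw [Set.ncard_le_one (Set.toFinite _)]
      intro x hx y hy
      by_contra hne
      exact (key x y ((nextPart c).trans ((nextPart c).symm hx.1) hy.1) hne).elim hx.2 hy.2
    have h2 := Set.ncard_sdiff_add_ncard_of_subset (runBlock_subset (c := c) hn)
    unfold baseSize
    omega
  have heq := le_antisymm hle (runLength_le_baseSize_nextPart hn)
  rcases nextPart_cases c with ⟨h, -⟩ | ⟨t, ht, -, h⟩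
  · rw [h, baseSize_top] at heq
    omega
  · rw [h] at heq hbase
    exact (runLength_spec hn c).2 t ht hbase heq

theorem toggle_ne_bot (hn : 2 ≤ n) (hc : runLength c < n) : toggle c ≠ ⊥ := fun h =>
  hc.ne (runLength_eq_of_isBase_toggle hn (h ▸ fun _ _ hxy hne => absurd hxy hne))

/-- Such a vertex lies below a member of the run whose base block is larger by one, so
`IsBase.of_le` applies. -/
theorem isBase_of_baseSize_add_one_lt {s : ProperPartition n} (hs : s ∈ c.1)
    (h : baseSize s.1 + 1 < runLength c) : IsBase s.1 := by
  obtain ⟨t, ht, hb, hk⟩ := exists_isBase_of_lt_runLength (c := c) (k := baseSize s.1 + 1)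
    (by have := one_le_baseSize s.1; omega) h
  exact hb.of_le (le_of_baseSize_lt hs ht (by omega)) hk.le

theorem baseBlock_eq_runBlock (hn : 2 ≤ n) {s : ProperPartition n} (hs : s ∈ c.1)
    (h : baseSize s.1 + 1 = runLength c) : baseBlock s.1 = runBlock c := by
  rcases runBlock_cases hn c with ⟨h1, h2⟩ | ⟨t, ht, -, h1, h2⟩
  · symm
    refine Set.eq_of_subset_of_ncard_le ?_ ?_
    · rw [h2, Set.singleton_subset_iff]
      exact s.1.refl 0
    · rw [h2, Set.ncard_singleton]
      change baseSize s.1 ≤ 1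
      omega
  · rw [h2]
    rcases le_or_le_of_mem hs ht with h3 | h3
    · exact baseBlock_eq_of_le h3 (by omega)
    · exact (baseBlock_eq_of_le h3 (by omega)).symm

theorem le_toggle (hn : 2 ≤ n) {s : ProperPartition n} (hs : s ∈ c.1)
    (hk : baseSize s.1 < runLength c) : s.1 ≤ toggle c := by
  refine le_inf (le_nextPart hs hk) fun x y hxy => ?_
  rw [Setoid.ker_def, eq_iff_iff]
  -- At base size `K - 1` the vertex need not be base, but its base block is the run block; below
  -- that size it belongs to the run or has only the singleton base block, and in either case is
  -- base.
  rcases (Nat.succ_le_of_lt hk).eq_or_lt with h | h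
  · rw [← baseBlock_eq_runBlock hn hs h]
    exact ⟨fun hx => s.1.trans hx hxy, fun hy => s.1.trans hy (s.1.symm hxy)⟩
  · have hb := isBase_of_baseSize_add_one_lt hs h
    rcases eq_or_ne x y with rfl | hne
    · exact Iff.rfl
    · have hx := hb x y hxy hne
      exact iff_of_true (Or.inr ⟨s, hs, hb, hk, hx⟩) (Or.inr ⟨s, hs, hb, hk, s.1.trans hx hxy⟩)

theorem le_or_le_toggle (hn : 2 ≤ n) {s : ProperPartition n} (hs : s ∈ c.1) :
    s.1 ≤ toggle c ∨ toggle c ≤ s.1 := by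
  rcases lt_or_ge (baseSize s.1) (runLength c) with h | h
  · exact Or.inl (le_toggle hn hs h)
  · exact Or.inr (toggle_le_nextPart.trans (nextPart_le hs h))

/-! ### Invariance of the run and the next partition under toggling -/

theorem runLength_congr (h : ∀ s : ProperPartition n, IsBase s.1 → (s ∈ c.1 ↔ s ∈ d.1)) :
    runLength c = runLength d := by
  have : ∀ k, (∀ s ∈ c.1, IsBase s.1 → baseSize s.1 ≠ k) ↔
      ∀ s ∈ d.1, IsBase s.1 → baseSize s.1 ≠ k := fun k =>
    ⟨fun h1 s hs hb => h1 s ((h s hb).2 hs) hb, fun h1 s hs hb => h1 s ((h s hb).1 hs) hb⟩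
  simp only [runLength, this]

theorem nextPart_congr (hK : runLength c = runLength d)
    (h : ∀ s : ProperPartition n, runLength c ≤ baseSize s.1 → (s ∈ c.1 ↔ s ∈ d.1)) :
    nextPart c = nextPart d := by
  unfold nextPart
  congr 1
  ext s
  constructor
  · rintro ⟨t, ht, rfl, hk⟩
    exact ⟨t, (h t hk).1 ht, rfl, hK ▸ hk⟩
  · rintro ⟨t, ht, rfl, hk⟩
    rw [← hK] at hk
    exact ⟨t, (h t hk).2 ht, rfl, hk⟩

/-- Toggling the partition `toggle c` changes neither the run nor the partition to be toggled. -/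
theorem toggle_congr (hn : 2 ≤ n) (hc : runLength c < n)
    (h : ∀ s : ProperPartition n, s.1 ≠ toggle c → (s ∈ c.1 ↔ s ∈ d.1)) :
    runLength d = runLength c ∧ toggle d = toggle c ∧
      ∀ s : ProperPartition n, runLength c ≤ baseSize s.1 → (s ∈ c.1 ↔ s ∈ d.1) := by
  -- The run sees only base vertices, and `toggle c` is not one; the next partition sees only base
  -- sizes at least `K`, and `toggle c` has size `K - 1`.
  have hbase : ∀ s : ProperPartition n, IsBase s.1 → (s ∈ c.1 ↔ s ∈ d.1) := fun s hs =>
    h s fun he => hc.ne (runLength_eq_of_isBase_toggle hn (he ▸ hs))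
  have hK := runLength_congr hbase
  have hbig : ∀ s : ProperPartition n, runLength c ≤ baseSize s.1 → (s ∈ c.1 ↔ s ∈ d.1) :=
    fun s hs => h s fun he => by
      have := baseSize_toggle (c := c) hn
      rw [he] at hs
      omega
  refine ⟨hK.symm, ?_, hbig⟩
  have hB : runBlock c = runBlock d := by
    ext x
    refine or_congr Iff.rfl ⟨?_, ?_⟩
    · rintro ⟨s, hs, hb, hk, hx⟩
      exact ⟨s, (hbase s hb).1 hs, hb, hK ▸ hk, hx⟩
    · rintro ⟨s, hs, hb, hk, hx⟩
      exact ⟨s, (hbase s hb).2 hs, hb, hK.symm ▸ hk, hx⟩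
  rw [toggle, toggle, hB, nextPart_congr hK hbig]

end Run

/-! ### The matching of simplices -/

section Pairs

variable {n : ℕ} [NeZero n]

/-- The simplex `d` arises from `c` by adding the partition `toggle c`. -/
def IsTogglePair (c d : PartitionSimplex n) : Prop :=
  runLength c < n ∧ ∃ r : ProperPartition n, r.1 = toggle c ∧ r ∉ c.1 ∧
    ∀ s, s ∈ d.1 ↔ s = r ∨ s ∈ c.1

variable {c d e : PartitionSimplex n}

namespace IsTogglePair

theorem le (h : IsTogglePair c d) : c ≤ d := by
  obtain ⟨-, r, -, -, h⟩ := h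
  exact fun s hs => (h s).2 (Or.inr hs)

theorem card_eq (h : IsTogglePair c d) : d.1.card = c.1.card + 1 := by
  classical
  obtain ⟨-, r, -, hr, h⟩ := h
  rw [← Finset.card_insert_of_notMem hr]
  congr 1
  ext s
  rw [h, Finset.mem_insert]

theorem congr (hn : 2 ≤ n) (h : IsTogglePair c d) :
    runLength d = runLength c ∧ toggle d = toggle c ∧
      ∀ s : ProperPartition n, runLength c ≤ baseSize s.1 → (s ∈ c.1 ↔ s ∈ d.1) := by
  obtain ⟨hK, r, hr, hrc, h⟩ := h
  refine toggle_congr hn hK fun s hs => ?_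
  rw [h]
  exact ⟨Or.inr, fun h1 => h1.resolve_left fun he => hs (he ▸ hr)⟩

theorem right_unique (h : IsTogglePair c d) (h' : IsTogglePair c e) : d = e := by
  obtain ⟨-, r, hr, -, h⟩ := h
  obtain ⟨-, r', hr', -, h'⟩ := h'
  obtain rfl : r = r' := Subtype.ext (hr.trans hr'.symm)
  refine Subtype.ext (Finset.ext fun s => ?_)
  rw [h, h']

theorem mem_iff (h : IsTogglePair c d) (s : ProperPartition n) :
    s ∈ c.1 ↔ s ∈ d.1 ∧ s.1 ≠ toggle c := by
  obtain ⟨-, r, hr, hrc, h⟩ := h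
  rw [h, ← hr, Ne, ← Subtype.ext_iff]
  constructor
  · intro hs
    exact ⟨Or.inr hs, fun he => hrc (he ▸ hs)⟩
  · rintro ⟨rfl | hs, hne⟩
    · exact absurd rfl hne
    · exact hs

/-- The removed partition can be read off from the larger simplex, as it equals `toggle e`. -/
theorem left_unique (hn : 2 ≤ n) (h : IsTogglePair c e) (h' : IsTogglePair d e) : c = d := by
  have ht : toggle c = toggle d := (h.congr hn).2.1.symm.trans (h'.congr hn).2.1
  refine Subtype.ext (Finset.ext fun s => ?_)
  rw [h.mem_iff, h'.mem_iff, ht]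

theorem toggle_notMem (h : IsTogglePair c d) {s : ProperPartition n} (hs : s ∈ c.1) :
    s.1 ≠ toggle c := ((h.mem_iff s).1 hs).2

theorem exists_mem_eq_toggle (hn : 2 ≤ n) (h : IsTogglePair c d) :
    ∃ s ∈ d.1, s.1 = toggle d := by
  obtain ⟨r, hr, -, h1⟩ := h.2
  exact ⟨r, (h1 r).2 (Or.inl rfl), hr.trans (h.congr hn).2.1.symm⟩

theorem not_isTogglePair (hn : 2 ≤ n) (h : IsTogglePair c d) : ¬ IsTogglePair d e := fun h' => by
  obtain ⟨s, hs, he⟩ := h.exists_mem_eq_toggle hn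
  exact h'.toggle_notMem hs he

end IsTogglePair

theorem exists_isTogglePair_left (hn : 2 ≤ n) (hK : runLength c < n)
    (h : ∀ s ∈ c.1, s.1 ≠ toggle c) : ∃ d, IsTogglePair c d := by
  classical
  let r : ProperPartition n := ⟨toggle c, toggle_ne_bot hn hK, toggle_ne_top hn⟩
  refine ⟨⟨insert r c.1, Finset.insert_nonempty _ _, ?_⟩, hK, r, rfl, fun hr => h r hr rfl,
    fun s => Finset.mem_insert⟩
  rw [Finset.coe_insert]
  exact c.2.2.insert fun s hs _ => (le_or_le_toggle hn hs).symm

/-- Removal is obstructed only if `toggle c` is the sole vertex. Then the run is empty and the next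
partition is `⊤`, so the toggle splits off `{0}` and `c` is the vertex `α_n`. -/
theorem exists_isTogglePair_right (hn : 3 ≤ n) (hK : runLength c < n)
    (hα : c ≠ alphaSimplex n hn) {r : ProperPartition n} (hrc : r ∈ c.1) (hr : r.1 = toggle c) :
    ∃ d, IsTogglePair d c := by
  classical
  have hn2 : 2 ≤ n := by omega
  have hne : (c.1.erase r).Nonempty := by
    by_contra hemp
    rw [Finset.not_nonempty_iff_eq_empty, Finset.erase_eq_empty_iff] at hemp
    have hc : ∀ s ∈ c.1, s = r := by
      rcases hemp with h | h
      · simp [h]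
      · simp [h]
    have hbr := baseSize_toggle (c := c) hn2
    have hB : runBlock c = {0} := by
      rcases runBlock_cases hn2 c with ⟨-, h⟩ | ⟨t, ht, hb, -, -⟩
      · exact h
      · rw [hc t ht, hr] at hb
        exact absurd (runLength_eq_of_isBase_toggle hn2 hb) hK.ne
    have hnext : nextPart c = ⊤ := by
      rcases nextPart_cases c with ⟨h, -⟩ | ⟨t, ht, hk, -⟩
      · exact h
      · rw [hc t ht, hr] at hk
        omega
    have hra : r = alphaPartition n hn := by
      refine Subtype.ext ?_
      rw [hr, toggle, hnext, hB, top_inf_eq]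
      rfl
    refine hα (Subtype.ext ?_)
    change c.1 = {alphaPartition n hn}
    rw [← hra]
    exact Finset.eq_singleton_iff_unique_mem.2 ⟨hrc, hc⟩
  let d : PartitionSimplex n := ⟨c.1.erase r, hne, c.2.2.mono (Finset.erase_subset _ _)⟩
  have hd : ∀ s, s ∈ d.1 ↔ s ≠ r ∧ s ∈ c.1 := fun s => Finset.mem_erase
  have h := toggle_congr (c := c) (d := d) hn2 hK fun s hs => by
    rw [hd]
    exact ⟨fun h => ⟨fun he => hs (he ▸ hr), h⟩, fun h => h.2⟩
  refine ⟨d, h.1.trans_lt hK, r, hr.trans h.2.1.symm, fun h => ((hd r).1 h).1 rfl, fun s => ?_⟩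
  rw [hd]
  by_cases hs : s = r <;> simp [hs, hrc]

/-! ### Simplices with a full run -/

/-- In a chain of base partitions, base size is injective with values in `{2, …, n - 1}`. Dimension
`n - 3` means that all `n - 2` sizes occur. -/
theorem runLength_eq_iff (hn : 3 ≤ n) : runLength c = n ↔ c ∈ baseSimplices n := by
  have hn2 : 2 ≤ n := by omega
  have hinj : (∀ s ∈ c.1, IsBase s.1) → Set.InjOn (fun s : ProperPartition n => baseSize s.1) c.1 := by
    intro hb s hs t ht hst
    simp only at hst
    refine Subtype.ext ((hb s hs).eq_of_baseBlock_eq (hb t ht) ?_)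
    rcases le_or_le_of_mem hs ht with h | h
    · exact baseBlock_eq_of_le h hst.ge
    · exact (baseBlock_eq_of_le h hst.le).symm
  have hmaps : (∀ s ∈ c.1, IsBase s.1) →
      c.1.image (fun s : ProperPartition n => baseSize s.1) ⊆ Finset.Ico 2 n := by
    intro hb k hk
    obtain ⟨s, hs, rfl⟩ := Finset.mem_image.1 hk
    exact Finset.mem_Ico.2 ⟨(hb s hs).two_le_baseSize s.2.1, baseSize_lt s.2.2⟩
  -- Nonemptiness makes the truncated subtraction in `dim` exact; for `n = 3` it excludes
  -- cardinality zero.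
  have hpos : 0 < c.1.card := Finset.card_pos.2 c.2.1
  constructor
  · intro hK
    have hb : ∀ s ∈ c.1, IsBase s.1 := by
      intro s hs
      rcases (Nat.succ_le_of_lt (baseSize_lt s.2.2)).eq_or_lt with h | h
      · have htop : IsBase (⊤ : Setoid (Fin n)) := fun _ _ _ _ => trivial
        exact htop.of_le le_top (by rw [baseSize_top]; exact h.ge)
      · exact isBase_of_baseSize_add_one_lt hs (by rw [hK]; exact h)
    refine ⟨fun s hs => mem_baseBlockVertices.2 (hb s hs), ?_⟩
    have himg : c.1.image (fun s : ProperPartition n => baseSize s.1) = Finset.Ico 2 n := by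
      refine (hmaps hb).antisymm fun k hk => ?_
      obtain ⟨h2, hkn⟩ := Finset.mem_Ico.1 hk
      obtain ⟨s, hs, -, hsk⟩ := exists_isBase_of_lt_runLength (c := c) h2 (hkn.trans_eq hK.symm)
      exact Finset.mem_image.2 ⟨s, hs, hsk⟩
    have hcard := Finset.card_image_of_injOn (hinj hb)
    rw [himg, Nat.card_Ico] at hcard
    rw [PartitionSimplex.dim, ← hcard]
    omega
  · rintro ⟨hb, hdim⟩
    replace hb : ∀ s ∈ c.1, IsBase s.1 := fun s hs => mem_baseBlockVertices.1 (hb s hs)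
    rw [PartitionSimplex.dim] at hdim
    have himg : c.1.image (fun s : ProperPartition n => baseSize s.1) = Finset.Ico 2 n := by
      refine Finset.eq_of_subset_of_card_le (hmaps hb) ?_
      rw [Finset.card_image_of_injOn (hinj hb), Nat.card_Ico]
      omega
    by_contra hne
    have hlt : runLength c < n := lt_of_le_of_ne (runLength_le hn2 c) hne
    have hmem := Finset.mem_Ico.2 ⟨(runLength_spec hn2 c).1, hlt⟩
    rw [← himg] at hmem
    obtain ⟨s, hs, hsk⟩ := Finset.mem_image.1 hmem
    exact (runLength_spec hn2 c).2 s hs (hb s hs) hsk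

/-! ### The height function behind acyclicity -/

/-- A quantity that strictly decreases along the gradient paths of the matching. -/
noncomputable def gradientHeight (c : PartitionSimplex n) : ℕ ×ₗ ℕ :=
  toLex (runLength c, {s | s ∈ c.1 ∧ runLength c ≤ baseSize s.1}.ncard)

/-- The added vertex has base size `K - 1`, just below the threshold for being counted. -/
theorem IsTogglePair.gradientHeight_eq (hn : 2 ≤ n) (h : IsTogglePair c d) :
    gradientHeight d = gradientHeight c := by
  obtain ⟨h1, -, h2⟩ := h.congr hn
  have : {s : ProperPartition n | s ∈ d.1 ∧ runLength c ≤ baseSize s.1} =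
      {s | s ∈ c.1 ∧ runLength c ≤ baseSize s.1} := by
    ext s
    exact and_congr_left fun hs => (h2 s hs).symm
  rw [gradientHeight, gradientHeight, h1, this]

theorem runLength_mono (hn : 2 ≤ n) (h : c ≤ d) : runLength c ≤ runLength d :=
  Nat.sInf_le ⟨(runLength_spec hn d).1, fun s hs => (runLength_spec hn d).2 s (h hs)⟩

/-- Passing to a face does not increase the height; if it stays the same, the toggled partition
stays the same. -/
theorem gradientHeight_lt_or_toggle_eq (hn : 2 ≤ n) (h : c ≤ d) :
    gradientHeight c < gradientHeight d ∨ toggle c = toggle d := by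
  rcases (runLength_mono hn h).lt_or_eq with hlt | heq
  · exact Or.inl (Prod.Lex.toLex_lt_toLex.2 (Or.inl hlt))
  have hsub : {s | s ∈ c.1 ∧ runLength c ≤ baseSize s.1} ⊆
      {s | s ∈ d.1 ∧ runLength d ≤ baseSize s.1} := fun s hs => ⟨h hs.1, heq ▸ hs.2⟩
  have hfin : {s | s ∈ d.1 ∧ runLength d ≤ baseSize s.1}.Finite :=
    d.1.finite_toSet.subset fun s hs => hs.1
  rcases (Set.ncard_le_ncard hsub hfin).lt_or_eq with hlt | hcard
  · exact Or.inl (Prod.Lex.toLex_lt_toLex.2 (Or.inr ⟨heq, hlt⟩))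
  right
  have hset := Set.eq_of_subset_of_ncard_le hsub hcard.ge hfin
  have hnext : nextPart c = nextPart d := nextPart_congr heq fun s hs =>
    ⟨fun hc => h hc, fun hd => ((Set.ext_iff.1 hset s).2 ⟨hd, heq ▸ hs⟩).1⟩
  -- The run blocks are nested and both have `K - 1` elements.
  have hB : runBlock c = runBlock d := by
    refine Set.eq_of_subset_of_ncard_le ?_ ?_
    · rintro x (hx | ⟨s, hs, hb, hk, hx⟩)
      · exact Or.inl hx
      · exact Or.inr ⟨s, h hs, hb, heq ▸ hk, hx⟩
    · have h1 := ncard_runBlock hn c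
      have h2 := ncard_runBlock hn d
      omega
  rw [toggle, toggle, hnext, hB]

/-- Without a strict increase, `a` and `b'` have the same toggle. Since `b'` already contains it,
adding it to `a` stays inside `b'`. -/
theorem IsTogglePair.le_or_gradientHeight_lt (hn : 2 ≤ n) {a b a' b' : PartitionSimplex n}
    (h : IsTogglePair a b) (h' : IsTogglePair a' b') (hle : a ≤ b') :
    b ≤ b' ∨ gradientHeight b < gradientHeight b' := by
  rw [h.gradientHeight_eq hn]
  refine (gradientHeight_lt_or_toggle_eq hn hle).symm.imp_left fun heq => ?_
  obtain ⟨t, ht, htb⟩ := h'.exists_mem_eq_toggle hn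
  obtain ⟨-, r, hr, -, hb⟩ := h
  intro s hs
  rcases (hb s).1 hs with rfl | hs
  · rwa [Subtype.ext (hr.trans (heq.trans htb.symm))]
  · exact hle hs

end Pairs

/-! ### Equivariance -/

section Equivariance

variable {n : ℕ} [NeZero n] {g : Equiv.Perm (Fin n)}

theorem PartitionSimplex.mem_smul {n : ℕ} {g : Equiv.Perm (Fin n)} {c : PartitionSimplex n}
    {s : ProperPartition n} : g • s ∈ (g • c).1 ↔ s ∈ c.1 := by
  rw [PartitionSimplex.smul_val]
  exact Finset.mem_map' _

theorem PartitionSimplex.forall_mem_smul {n : ℕ} {g : Equiv.Perm (Fin n)} {c : PartitionSimplex n}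
    {p : ProperPartition n → Prop} : (∀ s ∈ (g • c).1, p s) ↔ ∀ s ∈ c.1, p (g • s) := by
  rw [PartitionSimplex.smul_val]
  exact Finset.forall_mem_map

theorem PartitionSimplex.exists_mem_smul {n : ℕ} {g : Equiv.Perm (Fin n)} {c : PartitionSimplex n}
    {p : ProperPartition n → Prop} : (∃ s ∈ (g • c).1, p s) ↔ ∃ s ∈ c.1, p (g • s) := by
  constructor
  · rintro ⟨s, hs, h⟩
    obtain ⟨s, rfl⟩ := MulAction.surjective g s
    exact ⟨s, mem_smul.1 hs, h⟩
  · rintro ⟨s, hs, h⟩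
    exact ⟨g • s, mem_smul.2 hs, h⟩

theorem smul_rel_smul {n : ℕ} (g : Equiv.Perm (Fin n)) (s : ProperPartition n) (x y : Fin n) :
    (g • s).1 (g x) (g y) ↔ s.1 x y := by
  simp [ProperPartition.smul_rel]

theorem smul_rel_zero (hg : g 0 = 0) (s : ProperPartition n) (x : Fin n) :
    (g • s).1 0 (g x) ↔ s.1 0 x := by
  conv_lhs => rw [← hg]
  exact smul_rel_smul g s 0 x

theorem baseSize_smul (hg : g 0 = 0) (s : ProperPartition n) :
    baseSize (g • s).1 = baseSize s.1 := by
  have : baseBlock (g • s).1 = g '' baseBlock s.1 := by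
    ext x
    obtain ⟨x, rfl⟩ := g.surjective x
    rw [g.injective.mem_set_image, mem_baseBlock, mem_baseBlock, smul_rel_zero hg]
  rw [baseSize, this, Set.ncard_image_of_injective _ g.injective, baseSize]

theorem isBase_smul (hg : g 0 = 0) (s : ProperPartition n) : IsBase (g • s).1 ↔ IsBase s.1 := by
  refine g.surjective.forall₂.trans (forall₂_congr fun x y => ?_)
  rw [smul_rel_smul, smul_rel_zero hg, g.injective.ne_iff]

theorem runLength_smul (hg : g 0 = 0) (c : PartitionSimplex n) :
    runLength (g • c) = runLength c := by
  simp only [runLength, PartitionSimplex.forall_mem_smul, isBase_smul hg, baseSize_smul hg]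

theorem mem_runBlock_smul (hg : g 0 = 0) (c : PartitionSimplex n) (x : Fin n) :
    g x ∈ runBlock (g • c) ↔ x ∈ runBlock c := by
  simp only [runBlock, Set.mem_ofPred_eq, PartitionSimplex.exists_mem_smul, isBase_smul hg,
    baseSize_smul hg, smul_rel_zero hg, runLength_smul hg]
  rw [← g.injective.eq_iff (a := x), hg]

/-- This pointwise form of the infimum, with `⊤` as the empty case, transports directly along
permutations. -/
theorem nextPart_rel {c : PartitionSimplex n} {x y : Fin n} :
    nextPart c x y ↔ ∀ s ∈ c.1, runLength c ≤ baseSize s.1 → s.1 x y := by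
  change (∀ r, (∃ t ∈ c.1, t.1 = r ∧ runLength c ≤ baseSize r) → r x y) ↔ _
  constructor
  · exact fun h s hs hk => h s.1 ⟨s, hs, rfl, hk⟩
  · rintro h _ ⟨t, ht, rfl, hk⟩
    exact h t ht hk

theorem toggle_smul_rel (hg : g 0 = 0) (c : PartitionSimplex n) (x y : Fin n) :
    toggle (g • c) (g x) (g y) ↔ toggle c x y := by
  simp only [toggle_rel, nextPart_rel, PartitionSimplex.forall_mem_smul, runLength_smul hg,
    baseSize_smul hg, smul_rel_smul, mem_runBlock_smul hg]

theorem smul_eq_toggle_smul (hg : g 0 = 0) {c : PartitionSimplex n} {s : ProperPartition n}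
    (h : s.1 = toggle c) : (g • s).1 = toggle (g • c) := by
  ext x y
  obtain ⟨x, rfl⟩ := g.surjective x
  obtain ⟨y, rfl⟩ := g.surjective y
  rw [smul_rel_smul, toggle_smul_rel hg, h]

theorem IsTogglePair.smul (hg : g 0 = 0) {c d : PartitionSimplex n} (h : IsTogglePair c d) :
    IsTogglePair (g • c) (g • d) := by
  obtain ⟨hK, r, hr, hrc, h⟩ := h
  refine ⟨by rwa [runLength_smul hg], g • r, smul_eq_toggle_smul hg hr,
    by rwa [PartitionSimplex.mem_smul], fun s => ?_⟩
  obtain ⟨s, rfl⟩ := MulAction.surjective g s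
  rw [PartitionSimplex.mem_smul, PartitionSimplex.mem_smul, h, smul_left_cancel_iff]

theorem gradientHeight_smul (hg : g 0 = 0) (c : PartitionSimplex n) :
    gradientHeight (g • c) = gradientHeight c := by
  have : {s | s ∈ (g • c).1 ∧ runLength c ≤ baseSize s.1} =
      (g • ·) '' {s : ProperPartition n | s ∈ c.1 ∧ runLength c ≤ baseSize s.1} := by
    ext s
    obtain ⟨s, rfl⟩ := MulAction.surjective g s
    rw [(MulAction.injective g).mem_set_image]
    simp only [Set.mem_ofPred_eq, PartitionSimplex.mem_smul, baseSize_smul hg]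
  rw [gradientHeight, runLength_smul hg, this, Set.ncard_image_of_injective _ (MulAction.injective g),
    gradientHeight]

end Equivariance

/-! ### The matching of the quotient -/

section Quotient

variable {n : ℕ} {G : Subgroup (Equiv.Perm (Fin n))}

theorem QuotientSimplex.exists_rep (x : QuotientSimplex n G) : ∃ c, mk G c = x :=
  Quotient.exists_rep x

theorem QuotientSimplex.card_lt_of_mk_lt {c d : PartitionSimplex n} (h : mk G c < mk G d) :
    c.1.card < d.1.card := by
  obtain ⟨g, hg, hle⟩ := mk_le_mk.1 h.le
  have hc : (g • c).1.card = c.1.card := by simp [PartitionSimplex.smul_val]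
  refine lt_of_le_of_ne (hc ▸ Finset.card_le_card hle) fun he => h.ne ?_
  refine mk_eq_mk.2 ⟨g, hg, Subtype.ext (Finset.eq_of_subset_of_card_le hle ?_)⟩
  rw [hc, he]

/-- The pairs of classes of simplices that are matched. -/
def toggleMatching (G : Subgroup (Equiv.Perm (Fin n))) [NeZero n] :
    Set (QuotientSimplex n G × QuotientSimplex n G) :=
  {p | ∃ c d, IsTogglePair c d ∧ p = (QuotientSimplex.mk G c, QuotientSimplex.mk G d)}

variable [NeZero n]

theorem smul_zero_of_mem (hG : G ≤ MulAction.stabilizer (Equiv.Perm (Fin n)) (0 : Fin n))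
    {g : Equiv.Perm (Fin n)} (hg : g ∈ G) : g 0 = 0 := hG hg

/-- By equivariance a matched pair of orbits can be lifted to a toggle pair starting at any
prescribed representative. Uniqueness in the quotient thus reduces to uniqueness for simplices. -/
theorem exists_isTogglePair_of_fst
    (hG : G ≤ MulAction.stabilizer (Equiv.Perm (Fin n)) (0 : Fin n)) {c : PartitionSimplex n}
    {p : QuotientSimplex n G × QuotientSimplex n G} (hp : p ∈ toggleMatching G)
    (h : QuotientSimplex.mk G c = p.1) :
    ∃ d, IsTogglePair c d ∧ p = (QuotientSimplex.mk G c, QuotientSimplex.mk G d) := by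
  obtain ⟨c', d', hp, rfl⟩ := hp
  obtain ⟨g, hg, rfl⟩ := QuotientSimplex.mk_eq_mk.1 h.symm
  exact ⟨g • d', hp.smul (smul_zero_of_mem hG hg),
    Prod.ext h.symm (QuotientSimplex.mk_eq_mk.2 ⟨g, hg, rfl⟩)⟩

theorem exists_isTogglePair_of_snd
    (hG : G ≤ MulAction.stabilizer (Equiv.Perm (Fin n)) (0 : Fin n)) {d : PartitionSimplex n}
    {p : QuotientSimplex n G × QuotientSimplex n G} (hp : p ∈ toggleMatching G)
    (h : QuotientSimplex.mk G d = p.2) :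
    ∃ c, IsTogglePair c d ∧ p = (QuotientSimplex.mk G c, QuotientSimplex.mk G d) := by
  obtain ⟨c', d', hp, rfl⟩ := hp
  obtain ⟨g, hg, rfl⟩ := QuotientSimplex.mk_eq_mk.1 h.symm
  exact ⟨g • c', hp.smul (smul_zero_of_mem hG hg),
    Prod.ext (QuotientSimplex.mk_eq_mk.2 ⟨g, hg, rfl⟩) h.symm⟩

theorem isPartialMatching_toggleMatching (hn : 2 ≤ n)
    (hG : G ≤ MulAction.stabilizer (Equiv.Perm (Fin n)) (0 : Fin n)) :
    IsPartialMatching (toggleMatching G) where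
  covBy := by
    rintro _ ⟨c, d, h, rfl⟩
    refine ⟨lt_of_le_of_ne ⟨c, d, rfl, rfl, h.le⟩ fun he => ?_, fun x h1 h2 => ?_⟩
    · obtain ⟨g, -, rfl⟩ := QuotientSimplex.mk_eq_mk.1 he
      have := h.card_eq
      simp [PartitionSimplex.smul_val] at this
    · obtain ⟨e, rfl⟩ := x.exists_rep
      have h3 := QuotientSimplex.card_lt_of_mk_lt h1
      have h4 := QuotientSimplex.card_lt_of_mk_lt h2
      have := h.card_eq
      omega
  unique := by
    intro x p hp q hq hxp hxq
    obtain ⟨c, rfl⟩ := x.exists_rep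
    rcases hxp with hxp | hxp <;> rcases hxq with hxq | hxq
    · obtain ⟨d, h, rfl⟩ := exists_isTogglePair_of_fst hG hp hxp
      obtain ⟨e, h', rfl⟩ := exists_isTogglePair_of_fst hG hq hxq
      rw [h.right_unique h']
    · obtain ⟨d, h, rfl⟩ := exists_isTogglePair_of_fst hG hp hxp
      obtain ⟨e, h', rfl⟩ := exists_isTogglePair_of_snd hG hq hxq
      exact absurd h (h'.not_isTogglePair hn)
    · obtain ⟨d, h, rfl⟩ := exists_isTogglePair_of_snd hG hp hxp
      obtain ⟨e, h', rfl⟩ := exists_isTogglePair_of_fst hG hq hxq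
      exact absurd h' (h.not_isTogglePair hn)
    · obtain ⟨d, h, rfl⟩ := exists_isTogglePair_of_snd hG hp hxp
      obtain ⟨e, h', rfl⟩ := exists_isTogglePair_of_snd hG hq hxq
      rw [h.left_unique hn h']

theorem isAcyclicMatching_toggleMatching (hn : 2 ≤ n)
    (hG : G ≤ MulAction.stabilizer (Equiv.Perm (Fin n)) (0 : Fin n)) :
    IsAcyclicMatching (toggleMatching G) where
  toIsPartialMatching := isPartialMatching_toggleMatching hn hG
  acyclic := by
    rintro ⟨k, a, b, hb, h⟩
    choose c d hcd hp using fun i => (h i).1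
    have hstep : ∀ i, gradientHeight (d i) < gradientHeight (d (i + 1)) := by
      intro i
      have ha : a i = QuotientSimplex.mk G (c i) := congrArg Prod.fst (hp i)
      have hbi : b i = QuotientSimplex.mk G (d i) := congrArg Prod.snd (hp i)
      have hbj : b (i + 1) = QuotientSimplex.mk G (d (i + 1)) := congrArg Prod.snd (hp (i + 1))
      have hcov := (h i).2
      rw [ha, hbj] at hcov
      obtain ⟨g, hg, hle⟩ := QuotientSimplex.mk_le_mk.1 hcov.le
      have hg0 := smul_zero_of_mem hG hg
      rcases ((hcd i).smul hg0).le_or_gradientHeight_lt hn (hcd (i + 1)) hle with h1 | h1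
      -- Here `[c i] < [d i] ≤ [d (i + 1)]`, so the covering relation forces `b i = b (i + 1)`,
      -- against injectivity on a cycle of length at least two.
      · exfalso
        have h2 : QuotientSimplex.mk G (d i) ≤ QuotientSimplex.mk G (d (i + 1)) :=
          QuotientSimplex.mk_le_mk.2 ⟨g, hg, h1⟩
        have h3 : QuotientSimplex.mk G (c i) < QuotientSimplex.mk G (d i) :=
          ((isPartialMatching_toggleMatching hn hG).covBy _ ⟨c i, d i, hcd i, rfl⟩).lt
        have h4 : i = i + 1 := hb ((hbi.trans (h2.eq_of_not_lt (hcov.2 h3))).trans hbj.symm)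
        simp at h4
      · rwa [gradientHeight_smul hg0] at h1
    obtain ⟨i, hi⟩ := Finite.exists_max fun i => gradientHeight (d i)
    exact (hi (i + 1)).not_gt (hstep i)

theorem criticalElements_toggleMatching (hn : 3 ≤ n)
    (hG : G ≤ MulAction.stabilizer (Equiv.Perm (Fin n)) (0 : Fin n)) :
    criticalElements (toggleMatching G) =
      QuotientSimplex.mk G '' baseSimplices n ∪ {QuotientSimplex.mk G (alphaSimplex n hn)} := by
  have hn2 : 2 ≤ n := by omega
  ext x
  constructor
  · intro hx
    obtain ⟨c, rfl⟩ := x.exists_rep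
    by_contra hc
    have hbase : c ∉ baseSimplices n := fun h => hc (Or.inl ⟨c, h, rfl⟩)
    have hα : c ≠ alphaSimplex n hn := fun h => hc (Or.inr (h ▸ rfl))
    have hK : runLength c < n :=
      lt_of_le_of_ne (runLength_le hn2 c) fun h => hbase ((runLength_eq_iff hn).1 h)
    by_cases hmem : ∃ s ∈ c.1, s.1 = toggle c
    · obtain ⟨r, hrc, hr⟩ := hmem
      obtain ⟨d, h⟩ := exists_isTogglePair_right hn hK hα hrc hr
      exact (hx _ ⟨d, c, h, rfl⟩).2 rfl
    · push Not at hmem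
      obtain ⟨d, h⟩ := exists_isTogglePair_left hn2 hK hmem
      exact (hx _ ⟨c, d, h, rfl⟩).1 rfl
  · rintro (⟨c, hc, rfl⟩ | rfl) p hp
    · have hK := (runLength_eq_iff hn).2 hc
      constructor
      · intro h
        obtain ⟨d, hd, -⟩ := exists_isTogglePair_of_fst hG hp h
        exact hd.1.ne hK
      · intro h
        obtain ⟨d, hd, -⟩ := exists_isTogglePair_of_snd hG hp h
        exact hd.1.ne ((hd.congr hn2).1.symm.trans hK)
    -- The vertex `α_n` is its own toggle, so nothing can be added; as a single vertex it cannot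
    -- arise by adding to a nonempty simplex.
    · constructor
      · intro h
        obtain ⟨d, hd, -⟩ := exists_isTogglePair_of_fst hG hp h
        have hα : alphaPartition n hn ∈ (alphaSimplex n hn).1 := Finset.mem_singleton_self _
        refine hd.toggle_notMem hα ?_
        have hsize : baseSize (alphaPartition n hn).1 = 1 := by
          rw [baseSize, Set.ncard_eq_one]
          refine ⟨0, Set.eq_singleton_iff_unique_mem.2 ⟨(alphaPartition n hn).1.refl 0, ?_⟩⟩
          exact fun x hx => (eq_iff_iff.1 hx).1 rfl
        have h2 := (runLength_spec hn2 (alphaSimplex n hn)).1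
        have hall : ∀ s ∈ (alphaSimplex n hn).1, s = alphaPartition n hn := fun s hs =>
          Finset.mem_singleton.1 hs
        have hnext : nextPart (alphaSimplex n hn) = ⊤ := by
          rcases nextPart_cases (alphaSimplex n hn) with ⟨h, -⟩ | ⟨t, ht, hk, -⟩
          · exact h
          · rw [hall t ht] at hk
            omega
        have hB : runBlock (alphaSimplex n hn) = {0} := by
          rcases runBlock_cases hn2 (alphaSimplex n hn) with ⟨-, h⟩ | ⟨t, ht, hb, -, -⟩
          · exact h
          · have := hb.two_le_baseSize t.2.1
            rw [hall t ht] at this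
            omega
        rw [toggle, hnext, hB, top_inf_eq]
        rfl
      · intro h
        obtain ⟨d, hd, -⟩ := exists_isTogglePair_of_snd hG hp h
        have h1 := hd.card_eq
        have h2 : 0 < d.1.card := Finset.card_pos.2 d.2.1
        have h3 : (alphaSimplex n hn).1.card = 1 := Finset.card_singleton _
        omega

end Quotient

theorem mainTheorem5 (n : ℕ) [NeZero n] (hn : 3 ≤ n) (G : Subgroup (Equiv.Perm (Fin n)))
    (hG : G ≤ MulAction.stabilizer (Equiv.Perm (Fin n)) (0 : Fin n)) :
    ∃ M : Set (QuotientSimplex n G × QuotientSimplex n G),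
      IsAcyclicMatching M ∧
      criticalElements M =
        QuotientSimplex.mk G '' baseSimplices n ∪ {QuotientSimplex.mk G (alphaSimplex n hn)} :=
  ⟨toggleMatching G, isAcyclicMatching_toggleMatching (by omega) hG,
    criticalElements_toggleMatching hn hG⟩
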